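/- **Theorem (Probabilistic guarantees of RelMCP).** Let $s(x,y,q)\in\mathbb{R}^{n_s}$ be a measurable score function, $J(q)\in\mathbb{R}$ a cost function, $q\in\mathbb{R}^{n_q}$ (neither needs to be convex in $q$). Let $\mathcal{Y}(x,q)=\{y : s(x,y,q)\le \mathbf{0}\}$ be the prediction set, and let $\eta(q)=\mathbb{P}(y\in\mathcal{Y}(x,q))$ be its coverage at a fresh point $(x,y)$. Let $(x^{(m)},y^{(m)})$, $m=1,\dots,n_{\mathrm{cal}}$, be i.i.d. calibration data from the same unknown distribution as the fresh point, put $\xi_m(q)=\max\{0,\max_j s_{(j)}(x^{(m)},y^{(m)},q)\}$, and fix $\varepsilon,\beta\in(0,1)$ and a predetermined (data-independent) grid of penalty parameters $\phi_1,\dots,\phi_{n_{\mathrm{eval}}}>0$. For each $i$ let $q_i^*$ be the solution reported for the program $$\min_{q\in\mathbb{R}^{n_q}}\; J(q)+\phi_i\sum_{m=1}^{n_{\mathrm{cal}}}\xi_m(q)$$ by a fixed solution rule, which assigns to every finite sample (a multiset of data points, of any size) a solution, or none, measurably in the data, and which is of one of two kinds: either it returns a global minimizer, ties being broken by a fixed,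 data-independent preference (and returns none only if there is no preferred global minimizer); or the point it returns need not be a global optimum, but does not change when data points with zero slack at it are added to the sample. Let the complexity $d_i$ be the number of $m$ with $\xi_m(q_i^*)>0$ plus the cardinality of a smallest additional subset of the calibration points from which, together with those points, the rule returns $q_i^*$. Let $\varepsilon_i\in(0,1)$ be the solution of $$\frac{\beta}{n_{\mathrm{eval}}\,n_{\mathrm{cal}}}\sum_{j=d_i}^{n_{\mathrm{cal}}-1}\frac{\binom{j}{d_i}}{\binom{n_{\mathrm{cal}}}{d_i}}\frac{1}{(1-\varepsilon_i)^{n_{\mathrm{cal}}-j}}=1 ,$$ and call $q_i^*$ valid if $\varepsilon_i$ exists and $\varepsilon_i\le\varepsilon$ (there is no solution if $d_i=n_{\mathrm{cal}}$). Then with probability at least $1-\beta$ over the calibration data, every valid $q_i^*$ satisfies $\eta(q_i^*)\ge 1-\varepsilon$. In particular, if $q^*$ is, almost surely, a valid grid solution, selected from the grid in any (data-dependent) way, then $\mathbb{P}(\eta(q^*)\ge 1-\varepsilon)\ge 1-\beta$. -/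

import Mathlib

open MeasureTheory ProbabilityTheory

namespace RelMCP

/-- The prediction set `{y | s(x, y, q) ≤ 0}` (componentwise). -/
def predictionSet {X Y : Type*} {nq ns : ℕ} (s : X → Y → (Fin nq → ℝ) → (Fin ns → ℝ))
    (x : X) (q : Fin nq → ℝ) : Set Y :=
  {y | ∀ j, s x y q j ≤ 0}

/-- The coverage `η(q)`: the probability that a fresh point `(x, y)` with law `P` satisfies
`y ∈ predictionSet s x q`. -/
noncomputable def coverage {X Y : Type*} [MeasurableSpace X] [MeasurableSpace Y] {nq ns : ℕ}
    (P : Measure (X × Y)) (s : X → Y → (Fin nq → ℝ) → (Fin ns → ℝ)) (q : Fin nq → ℝ) : ℝ :=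
  P.real {z | z.2 ∈ predictionSet s z.1 q}

/-- The slack `max {0, max_j s_j(x, y, q)}` of the data point `z = (x, y)` at `q`. -/
noncomputable def slack {X Y : Type*} {nq ns : ℕ} (s : X → Y → (Fin nq → ℝ) → (Fin ns → ℝ))
    (z : X × Y) (q : Fin nq → ℝ) : ℝ :=
  Finset.univ.fold max 0 (s z.1 z.2 q)

/-- The objective `J(q) + φ ∑_m ξ_m(q)` of the penalized program on a finite sample `S`
(a multiset: data points may repeat, and their order is irrelevant). -/
noncomputable def penalizedCost {X Y : Type*} {nq ns : ℕ}
    (s : X → Y → (Fin nq → ℝ) → (Fin ns → ℝ)) (J : (Fin nq → ℝ) → ℝ) (φ : ℝ)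
    (S : Multiset (X × Y)) (q : Fin nq → ℝ) : ℝ :=
  J q + φ * (S.map fun z => slack s z q).sum

/-- The set of global minimizers of the penalized program on the sample `S`. -/
def argminSet {X Y : Type*} {nq ns : ℕ}
    (s : X → Y → (Fin nq → ℝ) → (Fin ns → ℝ)) (J : (Fin nq → ℝ) → ℝ) (φ : ℝ)
    (S : Multiset (X × Y)) : Set (Fin nq → ℝ) :=
  {q | ∀ q', penalizedCost s J φ S q ≤ penalizedCost s J φ S q'}

/-- `A` is a rule by which the penalized program with penalty `φ` is solved: `A S` is the solution
reported for the finite sample `S`, and `A S = none` if none is reported (for instance because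
the program on `S` has no minimizer, as may happen when `S` is small).

* `globalMin`: the program is solved to global optimality, and ties between global minimizers are
  broken by a fixed preference `r` that does not depend on the data (if the global minimizer is
  unique, there is nothing to break).
* `nonGlobal`: the reported point is not required to be a global (or even a local) minimizer; it is
  only kept when data points are added that incur no slack at it. As slacks are nonnegative, such
  data points raise the objective nowhere below its value at the reported point: a global or local
  minimizer remains one, so this only fixes which of the optima is reported. -/
inductive IsSolutionRule {X Y : Type*} {nq ns : ℕ}
    (s : X → Y → (Fin nq → ℝ) → (Fin ns → ℝ)) (J : (Fin nq → ℝ) → ℝ) (φ : ℝ)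
    (A : Multiset (X × Y) → Option (Fin nq → ℝ)) : Prop
  | globalMin (r : (Fin nq → ℝ) → (Fin nq → ℝ) → Prop) (asymm : ∀ q q', r q q' → ¬ r q' q)
      (first : ∀ S q, A S = some q ↔
        q ∈ argminSet s J φ S ∧ ∀ q' ∈ argminSet s J φ S, q' ≠ q → r q q')
  | nonGlobal (keep : ∀ S T q, A S = some q → (∀ z ∈ T, slack s z q = 0) → A (S + T) = some q)

/-- The data points with index in `I`, as a multiset. -/
def subsample {Z : Type*} {n : ℕ} (D : Fin n → Z) (I : Finset (Fin n)) : Multiset Z :=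
  I.val.map D

/-- Measurability of a solution rule: for every sample size, the reported solution is a measurable
partial function of the sample. -/
def MeasurableRule {Z : Type*} [MeasurableSpace Z] {nq : ℕ}
    (A : Multiset Z → Option (Fin nq → ℝ)) : Prop :=
  ∀ (m : ℕ) (B : Set (Fin nq → ℝ)), MeasurableSet B →
    MeasurableSet {D : Fin m → Z | ∃ q ∈ B, A (subsample D Finset.univ) = some q}

/-- The indices of the data points that violate the constraint at `q`, i.e. have positive slack. -/
noncomputable def violated {X Y : Type*} {nq ns n : ℕ}
    (s : X → Y → (Fin nq → ℝ) → (Fin ns → ℝ)) (D : Fin n → X × Y) (q : Fin nq → ℝ) :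
    Finset (Fin n) :=
  {m | 0 < slack s (D m) q}

/-- The solution complexity of `q`, the solution reported by `A` on the sample `D`: the number of
data points with positive slack at `q`, plus the cardinality of a smallest additional set of data
points from which, together with the former, `A` returns `q`. -/
noncomputable def complexity {X Y : Type*} {nq ns n : ℕ}
    (s : X → Y → (Fin nq → ℝ) → (Fin ns → ℝ)) (A : Multiset (X × Y) → Option (Fin nq → ℝ))
    (D : Fin n → X × Y) (q : Fin nq → ℝ) : ℕ :=
  (violated s D q).card +
    sInf {k | ∃ I : Finset (Fin n), Disjoint (violated s D q) I ∧
      A (subsample D (violated s D q ∪ I)) = some q ∧ I.card = k}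

/-- `e ∈ (0, 1)` solves
`(b / n) ∑_{j = d}^{n - 1} (j choose d) / (n choose d) * 1 / (1 - e) ^ (n - j) = 1`.
For `0 < b < 1` there is exactly one such `e` if `d < n`, and none if `d = n`. -/
def IsMiscoverage (n d : ℕ) (b e : ℝ) : Prop :=
  0 < e ∧ e < 1 ∧
    b / n * ∑ j ∈ Finset.Ico d n,
      ((j.choose d : ℝ) / (n.choose d : ℝ)) * (1 / (1 - e) ^ (n - j)) = 1

/-- `q` is the solution reported by `A` on the full sample `D`, and its miscoverage, computed a
posteriori from its complexity at confidence parameter `b`, is at most the target `ε`. -/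
def IsValidSolution {X Y : Type*} {nq ns n : ℕ}
    (s : X → Y → (Fin nq → ℝ) → (Fin ns → ℝ)) (A : Multiset (X × Y) → Option (Fin nq → ℝ))
    (b ε : ℝ) (D : Fin n → X × Y) (q : Fin nq → ℝ) : Prop :=
  A (subsample D Finset.univ) = some q ∧
    ∃ e, IsMiscoverage n (complexity s A D q) b e ∧ e ≤ ε

end RelMCP

/-! Everything rests on stability: adding data points with zero slack at the reported solution does
not change it (`IsSolutionRule.isStable`). Convexity and global optimality play no further role.

Stability yields a sample compression scheme. Among the index sets `C` whose subsample already gives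
a solution with zero slack elsewhere, take the least in one fixed ranking by size. Its cardinality
is the complexity (`Selected.complexity_eq`), and it remains the choice on every intermediate set `M
⊇ C` (`Selected.of_univ`).

Let `x C` and `y M C` be the probabilities that `C` is chosen on the full sample, respectively on
`M`, with coverage below `1 - ε`. The points outside `M` are independent of those inside, so `x C ≤
(1 - ε) ^ (n - #M) * y M C` (`measureReal_badEvent_le`). The choice being unique, `∑ C, y M C ≤ 1`.
Averaging over the sets `M` of each size `j < n` turns the equation for the miscoverage into a dual
certificate that the `x C` of admissible size sum to at most `b` (`sum_weight_le`). A union bound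
over the grid, with `b = β / neval`, finishes the proof. -/

namespace RelMCP

/-! ### Slacks, coverage and stability of solution rules -/

section Slack

variable {X Y : Type*} {nq ns : ℕ}

lemma slack_nonneg (s : X → Y → (Fin nq → ℝ) → (Fin ns → ℝ)) (z : X × Y) (q : Fin nq → ℝ) :
    0 ≤ slack s z q :=
  Finset.le_fold_max _ |>.2 (Or.inl le_rfl)

lemma slack_pos_iff (s : X → Y → (Fin nq → ℝ) → (Fin ns → ℝ)) (z : X × Y) (q : Fin nq → ℝ) :
    0 < slack s z q ↔ ∃ j, 0 < s z.1 z.2 q j := by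
  simp [slack, Finset.lt_fold_max]

lemma slack_eq_zero_iff (s : X → Y → (Fin nq → ℝ) → (Fin ns → ℝ)) (z : X × Y) (q : Fin nq → ℝ) :
    slack s z q = 0 ↔ z.2 ∈ predictionSet s z.1 q := by
  rw [← not_iff_not, ← ne_eq, ← (slack_nonneg s z q).lt_iff_ne', slack_pos_iff]
  simp [predictionSet]

lemma measurableSet_slack_eq_zero [MeasurableSpace X] [MeasurableSpace Y]
    {s : X → Y → (Fin nq → ℝ) → (Fin ns → ℝ)}
    (hs : Measurable fun p : (X × Y) × (Fin nq → ℝ) => s p.1.1 p.1.2 p.2) :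
    MeasurableSet {p : (X × Y) × (Fin nq → ℝ) | slack s p.1 p.2 = 0} := by
  have h : {p : (X × Y) × (Fin nq → ℝ) | slack s p.1 p.2 = 0} =
      ⋂ j, {p | s p.1.1 p.1.2 p.2 j ≤ 0} := by
    ext p
    simp [slack_eq_zero_iff, predictionSet]
  rw [h]
  exact .iInter fun j => measurableSet_le ((measurable_pi_apply j).comp hs) measurable_const

lemma coverage_eq_slack [MeasurableSpace X] [MeasurableSpace Y] (P : Measure (X × Y))
    (s : X → Y → (Fin nq → ℝ) → (Fin ns → ℝ)) (q : Fin nq → ℝ) :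
    coverage P s q = P.real {z | slack s z q = 0} := by
  simp only [coverage, slack_eq_zero_iff]

lemma measurable_coverage [MeasurableSpace X] [MeasurableSpace Y] (P : Measure (X × Y))
    [IsProbabilityMeasure P] {s : X → Y → (Fin nq → ℝ) → (Fin ns → ℝ)}
    (hs : Measurable fun p : (X × Y) × (Fin nq → ℝ) => s p.1.1 p.1.2 p.2) :
    Measurable (coverage P s) := by
  have h := measurable_measure_prodMk_right (μ := P) (measurableSet_slack_eq_zero hs)
  have heq : coverage P s = fun q => (P {z | slack s z q = 0}).toReal :=
    funext fun q => coverage_eq_slack P s q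
  rw [heq]
  exact ENNReal.measurable_toReal.comp h

/-- A rule keeps its solution when data points without slack at it are added to the sample. -/
def IsStable (s : X → Y → (Fin nq → ℝ) → (Fin ns → ℝ))
    (A : Multiset (X × Y) → Option (Fin nq → ℝ)) : Prop :=
  ∀ S T q, A S = some q → (∀ z ∈ T, slack s z q = 0) → A (S + T) = some q

lemma IsSolutionRule.isStable {s : X → Y → (Fin nq → ℝ) → (Fin ns → ℝ)} {J : (Fin nq → ℝ) → ℝ}
    {φ : ℝ} (hφ : 0 < φ) {A : Multiset (X × Y) → Option (Fin nq → ℝ)}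
    (hA : IsSolutionRule s J φ A) : IsStable s A := by
  cases hA with
  | nonGlobal keep => exact keep
  | globalMin r asymm first =>
    intro S T q hq hT
    obtain ⟨hmin, hpref⟩ := (first S q).1 hq
    have hle : ∀ q', penalizedCost s J φ S q' ≤ penalizedCost s J φ (S + T) q' := fun q' => by
      have h : 0 ≤ (T.map fun z => slack s z q').sum :=
        Multiset.sum_nonneg fun x hx => by
          obtain ⟨z, -, rfl⟩ := Multiset.mem_map.1 hx
          exact slack_nonneg s z q'
      simp only [penalizedCost, Multiset.map_add, Multiset.sum_add]
      nlinarith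
    have heq : penalizedCost s J φ (S + T) q = penalizedCost s J φ S q := by
      have h : (T.map fun z => slack s z q).sum = 0 :=
        Multiset.sum_eq_zero fun x hx => by
          obtain ⟨z, hz, rfl⟩ := Multiset.mem_map.1 hx
          exact hT z hz
      simp only [penalizedCost, Multiset.map_add, Multiset.sum_add, h, add_zero]
    refine (first (S + T) q).2 ⟨fun q' => heq.trans_le ((hmin q').trans (hle q')), ?_⟩
    -- The optimal values on `S` and `S + T` agree, so a minimizer on `S + T` is also one on `S`,
    -- where `q` is already preferred.
    refine fun q' hq' hne => hpref q' (fun p => ?_) hne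
    exact (hle q').trans ((hq' q).trans (heq.trans_le (hmin p)))

end Slack

/-! ### The compression scheme of a stable rule -/

section Compression

variable {X Y : Type*} {nq ns n : ℕ}

/-- The subset `C` of `M` compresses the sample with indices in `M`: the rule returns a solution
on `C`, and the other points of `M` incur no slack at it. -/
def Compresses (s : X → Y → (Fin nq → ℝ) → (Fin ns → ℝ))
    (A : Multiset (X × Y) → Option (Fin nq → ℝ)) (D : Fin n → X × Y) (M C : Finset (Fin n)) :
    Prop :=
  C ⊆ M ∧ ∃ q, A (subsample D C) = some q ∧ ∀ i ∈ M, i ∉ C → slack s (D i) q = 0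

/-- An injective ranking of index sets by which smaller sets come first. -/
noncomputable def rank (C : Finset (Fin n)) : ℕ :=
  C.card * Fintype.card (Finset (Fin n)) + Fintype.equivFin (Finset (Fin n)) C

lemma rank_lt_of_card_lt {C C' : Finset (Fin n)} (h : C.card < C'.card) : rank C < rank C' := by
  have h1 := (Fintype.equivFin (Finset (Fin n)) C).isLt
  have h2 := Nat.mul_le_mul_right (Fintype.card (Finset (Fin n))) (Nat.succ_le_of_lt h)
  rw [Nat.succ_mul] at h2
  unfold rank
  omega

lemma rank_injective : Function.Injective (rank (n := n)) := by
  intro C C' h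
  have hc : C.card = C'.card := by
    rcases lt_trichotomy C.card C'.card with h' | h' | h'
    · exact absurd h (rank_lt_of_card_lt h').ne
    · exact h'
    · exact absurd h (rank_lt_of_card_lt h').ne'
  unfold rank at h
  rw [hc] at h
  exact (Fintype.equivFin _).injective (Fin.ext (by omega))

/-- `C` is the compression of the sample with indices in `M` of least rank. -/
def Selected (s : X → Y → (Fin nq → ℝ) → (Fin ns → ℝ))
    (A : Multiset (X × Y) → Option (Fin nq → ℝ)) (D : Fin n → X × Y) (M C : Finset (Fin n)) :
    Prop :=
  Compresses s A D M C ∧ ∀ C', Compresses s A D M C' → rank C ≤ rank C'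

variable {s : X → Y → (Fin nq → ℝ) → (Fin ns → ℝ)} {A : Multiset (X × Y) → Option (Fin nq → ℝ)}
  {D : Fin n → X × Y} {M C : Finset (Fin n)}

lemma IsStable.eq_some_of_subset (hA : IsStable s A) (hCM : C ⊆ M) {q : Fin nq → ℝ}
    (hq : A (subsample D C) = some q) (h : ∀ i ∈ M, i ∉ C → slack s (D i) q = 0) :
    A (subsample D M) = some q := by
  have hsplit : subsample D M = subsample D C + subsample D (M \ C) := by
    rw [subsample, subsample, subsample, ← Multiset.map_add, Finset.sdiff_val,
      add_tsub_cancel_of_le (Finset.val_le_iff.2 hCM)]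
  rw [hsplit]
  refine hA _ _ _ hq fun z hz => ?_
  obtain ⟨i, hi, rfl⟩ := Multiset.mem_map.1 hz
  obtain ⟨hiM, hiC⟩ := Finset.mem_sdiff.1 hi
  exact h i hiM hiC

/-- Breaking ties in cardinality makes the bad events for different `C` disjoint. -/
lemma Selected.unique {C' : Finset (Fin n)} (h : Selected s A D M C) (h' : Selected s A D M C') :
    C = C' :=
  rank_injective (le_antisymm (h.2 _ h'.1) (h'.2 _ h.1))

/-- By stability, any rival compression of `M` gives the same solution as `C`. The points outside
`M` have zero slack there, so the rival compresses the full sample too and cannot have smaller rank.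
-/
lemma Selected.of_univ (hA : IsStable s A) (h : Selected s A D Finset.univ C) (hCM : C ⊆ M) :
    Selected s A D M C := by
  obtain ⟨⟨-, q, hq, hz⟩, hmin⟩ := h
  refine ⟨⟨hCM, q, hq, fun i _ hi => hz i (Finset.mem_univ i) hi⟩, fun C' hC' => ?_⟩
  obtain ⟨hC'M, q', hq', hz'⟩ := hC'
  have h1 := hA.eq_some_of_subset hC'M hq' hz'
  have h2 := hA.eq_some_of_subset hCM hq fun i _ hi => hz i (Finset.mem_univ i) hi
  obtain rfl : q' = q := Option.some_injective _ (h1.symm.trans h2)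
  refine hmin C' ⟨Finset.subset_univ _, q', hq', fun i _ hi => ?_⟩
  by_cases hiM : i ∈ M
  · exact hz' i hiM hi
  · exact hz i (Finset.mem_univ i) fun hiC => hiM (hCM hiC)

lemma exists_selected {q : Fin nq → ℝ} (hq : A (subsample D M) = some q) :
    ∃ C, Selected s A D M C := by
  classical
  have hM : Compresses s A D M M := ⟨subset_rfl, q, hq, fun i hi hi' => absurd hi hi'⟩
  obtain ⟨C, hC, hmin⟩ := Finset.exists_min_image
    (Finset.univ.filter fun C => Compresses s A D M C) rank ⟨M, by simpa using hM⟩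
  exact ⟨C, by simpa using hC, fun C' hC' => hmin C' (by simpa using hC')⟩

/-- A compression must contain all violated points, and any set containing them that reproduces `q`
is a compression. Minimal rank therefore means minimal number of additional points. -/
lemma Selected.complexity_eq (hA : IsStable s A) {q : Fin nq → ℝ}
    (hq : A (subsample D Finset.univ) = some q) (h : Selected s A D Finset.univ C) :
    A (subsample D C) = some q ∧ complexity s A D q = C.card := by
  obtain ⟨⟨-, p, hp, hz⟩, hmin⟩ := h
  have h1 := hA.eq_some_of_subset (Finset.subset_univ C) hp hz
  obtain rfl : p = q := Option.some_injective _ (h1.symm.trans hq)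
  refine ⟨hp, ?_⟩
  have hVC : violated s D p ⊆ C := fun i hi => by
    by_contra hiC
    exact (Finset.mem_filter.1 hi).2.ne' (hz i (Finset.mem_univ i) hiC)
  have hinf : sInf {k | ∃ I : Finset (Fin n), Disjoint (violated s D p) I ∧
      A (subsample D (violated s D p ∪ I)) = some p ∧ I.card = k} =
      (C \ violated s D p).card := by
    refine le_antisymm (Nat.sInf_le ⟨_, Finset.disjoint_sdiff, ?_, rfl⟩) ?_
    · rwa [Finset.union_sdiff_of_subset hVC]
    · refine le_csInf ⟨_, C \ violated s D p, Finset.disjoint_sdiff, ?_, rfl⟩ ?_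
      · rwa [Finset.union_sdiff_of_subset hVC]
      · rintro _ ⟨I, hdisj, hI, rfl⟩
        have hle := hmin (violated s D p ∪ I) ⟨Finset.subset_univ _, p, hI, fun i _ hi => ?_⟩
        · have hcard : C.card ≤ (violated s D p ∪ I).card := by
            by_contra! hlt
            exact (rank_lt_of_card_lt hlt).not_ge hle
          rw [Finset.card_union_of_disjoint hdisj] at hcard
          rw [Finset.card_sdiff_of_subset hVC]
          omega
        · refine le_antisymm (not_lt.1 fun hpos => hi ?_) (slack_nonneg s _ _)
          exact Finset.mem_union_left _ (Finset.mem_filter.2 ⟨Finset.mem_univ i, hpos⟩)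
  rw [complexity, hinf, Finset.card_sdiff_of_subset hVC]
  have := Finset.card_le_card hVC
  omega

lemma subsample_congr {Z : Type*} {D D' : Fin n → Z} (h : ∀ i ∈ C, D i = D' i) :
    subsample D C = subsample D' C :=
  Multiset.map_congr rfl h

lemma Compresses.congr {D' : Fin n → X × Y} (hD : ∀ i ∈ M, D i = D' i)
    (h : Compresses s A D M C) : Compresses s A D' M C := by
  obtain ⟨hCM, q, hq, hz⟩ := h
  refine ⟨hCM, q, ?_, fun i hiM hi => ?_⟩
  · rwa [← subsample_congr fun i hi => hD i (hCM hi)]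
  · rw [← hD i hiM]; exact hz i hiM hi

lemma Selected.congr {D' : Fin n → X × Y} (hD : ∀ i ∈ M, D i = D' i)
    (h : Selected s A D M C) : Selected s A D' M C :=
  ⟨h.1.congr hD, fun C' hC' => h.2 C' (hC'.congr fun i hi => (hD i hi).symm)⟩

end Compression

/-! ### Measurability of solutions and of the selection -/

section Measurability

variable {X Y : Type*} [MeasurableSpace X] [MeasurableSpace Y] {nq ns n : ℕ}

/-- The solution reported on the subsample with indices in `C`, and `0` if there is none. -/
noncomputable def solution {Z : Type*} (A : Multiset Z → Option (Fin nq → ℝ))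
    (C : Finset (Fin n)) (D : Fin n → Z) : Fin nq → ℝ :=
  (A (subsample D C)).getD 0

/-- Enumerating `C` increasingly reduces subsamples to full samples of size `#C`, the only ones in
`MeasurableRule`. -/
lemma subsample_orderEmbOfFin {Z : Type*} (D : Fin n → Z) (C : Finset (Fin n)) :
    subsample (fun i => D (C.orderEmbOfFin rfl i)) Finset.univ = subsample D C := by
  have h : Finset.univ.map (C.orderEmbOfFin rfl).toEmbedding = C :=
    Finset.map_orderEmbOfFin_univ C rfl
  conv_rhs => rw [← h]
  rw [subsample, subsample, Finset.map_val, Multiset.map_map]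
  rfl

lemma MeasurableRule.measurableSet_subsample {Z : Type*} [MeasurableSpace Z]
    {A : Multiset Z → Option (Fin nq → ℝ)} (hA : MeasurableRule A) (C : Finset (Fin n))
    {B : Set (Fin nq → ℝ)} (hB : MeasurableSet B) :
    MeasurableSet {D : Fin n → Z | ∃ q ∈ B, A (subsample D C) = some q} := by
  have hm : Measurable fun (D : Fin n → Z) (i : Fin C.card) => D (C.orderEmbOfFin rfl i) :=
    measurable_pi_lambda _ fun i => measurable_pi_apply _
  have h := hm (hA C.card B hB)
  simpa only [Set.preimage_ofPred_eq, subsample_orderEmbOfFin] using h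

lemma MeasurableRule.measurable_solution {Z : Type*} [MeasurableSpace Z]
    {A : Multiset Z → Option (Fin nq → ℝ)} (hA : MeasurableRule A) (C : Finset (Fin n)) :
    Measurable (solution A C : (Fin n → Z) → Fin nq → ℝ) := by
  intro B hB
  have h1 := hA.measurableSet_subsample C hB
  have h2 := (hA.measurableSet_subsample C MeasurableSet.univ).compl
  have h3 : solution A C ⁻¹' B = {D : Fin n → Z | ∃ q ∈ B, A (subsample D C) = some q} ∪
      {D : Fin n → Z | ∃ q ∈ Set.univ, A (subsample D C) = some q}ᶜ ∩ {_D | (0 : Fin nq → ℝ) ∈ B} := by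
    ext D
    cases h : A (subsample D C) <;> simp [solution, h]
  rw [h3]
  exact h1.union (h2.inter (MeasurableSet.const _))

variable {s : X → Y → (Fin nq → ℝ) → (Fin ns → ℝ)} {A : Multiset (X × Y) → Option (Fin nq → ℝ)}

lemma measurableSet_compresses
    (hs : Measurable fun p : (X × Y) × (Fin nq → ℝ) => s p.1.1 p.1.2 p.2)
    (hA : MeasurableRule A) (M C : Finset (Fin n)) :
    MeasurableSet {D | Compresses s A D M C} := by
  have h : {D | Compresses s A D M C} = {_D | C ⊆ M} ∩
      ({D | ∃ q ∈ Set.univ, A (subsample D C) = some q} ∩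
        ⋂ i, {D | i ∈ M → i ∉ C → slack s (D i) (solution A C D) = 0}) := by
    ext D
    cases h : A (subsample D C) <;> simp [Compresses, solution, h]
  rw [h]
  refine (MeasurableSet.const _).inter
    ((hA.measurableSet_subsample C MeasurableSet.univ).inter (.iInter fun i => ?_))
  exact .imp (.const _) (.imp (.const _)
    (((measurable_pi_apply i).prodMk (hA.measurable_solution C)) (measurableSet_slack_eq_zero hs)))

lemma measurableSet_selected
    (hs : Measurable fun p : (X × Y) × (Fin nq → ℝ) => s p.1.1 p.1.2 p.2)
    (hA : MeasurableRule A) (M C : Finset (Fin n)) :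
    MeasurableSet {D | Selected s A D M C} := by
  simp only [Selected, Set.ofPred_and, Set.ofPred_forall]
  exact (measurableSet_compresses hs hA M C).inter (.iInter fun C' =>
    .imp (measurableSet_compresses hs hA M C') (.const _))

end Measurability

/-- Bounds the probability that a sample lies in a set `H` determined by the coordinates in `M`, and
all its other coordinates lie in a random set `G D` determined by the coordinates in `M` as well. -/
lemma pi_inter_forall_notMem_le {ι Z : Type*} [Fintype ι] [DecidableEq ι] [MeasurableSpace Z]
    (P : Measure Z) [IsProbabilityMeasure P] (M : Finset ι) {H : Set (ι → Z)}
    (hH : MeasurableSet H) (hHM : ∀ D D', (∀ i ∈ M, D i = D' i) → D ∈ H → D' ∈ H)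
    {G : (ι → Z) → Set Z} (hG : ∀ i, MeasurableSet {D : ι → Z | D i ∈ G D})
    (hGM : ∀ D D', (∀ i ∈ M, D i = D' i) → G D = G D')
    {c : ENNReal} (hc : ∀ D ∈ H, P (G D) ≤ c) :
    Measure.pi (fun _ => P) (H ∩ {D | ∀ i ∉ M, D i ∈ G D}) ≤
      c ^ (Fintype.card ι - M.card) * Measure.pi (fun _ => P) H := by
  obtain ⟨z⟩ : Nonempty Z := P.nonempty_of_neZero
  set e := MeasurableEquiv.piEquivPiSubtypeProd (fun _ : ι => Z) (· ∈ M)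
  have hmp := (measurePreserving_piEquivPiSubtypeProd (fun _ : ι => P) (· ∈ M)).symm e
  have hmem : ∀ a b i (hi : i ∈ M), e.symm (a, b) i = a ⟨i, hi⟩ := fun a b i hi => by
    simp [e, MeasurableEquiv.piEquivPiSubtypeProd, Equiv.piEquivPiSubtypeProd, hi]
  have hnotMem : ∀ a b i (hi : i ∉ M), e.symm (a, b) i = b ⟨i, hi⟩ := fun a b i hi => by
    simp [e, MeasurableEquiv.piEquivPiSubtypeProd, Equiv.piEquivPiSubtypeProd, hi]
  have hcongr : ∀ a b b', ∀ i ∈ M, e.symm (a, b) i = e.symm (a, b') i := fun a b b' i hi => by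
    rw [hmem a b i hi, hmem a b' i hi]
  have hE : MeasurableSet (H ∩ {D | ∀ i ∉ M, D i ∈ G D}) := by
    refine hH.inter ?_
    simp only [Set.ofPred_forall]
    exact .iInter fun i => .iInter fun _ => hG i
  -- Arbitrary filler values: neither `H` nor `G` depends on the coordinates outside `M`.
  set b₀ : {i // i ∉ M} → Z := fun _ => z
  set H' : Set ({i // i ∈ M} → Z) := {a | e.symm (a, b₀) ∈ H}
  have hH' : MeasurableSet H' := (e.symm.measurable.comp measurable_prodMk_right) hH
  have hHH' : ∀ a b, e.symm (a, b) ∈ H ↔ a ∈ H' := fun a b =>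
    ⟨hHM _ _ (hcongr a b b₀), hHM _ _ (hcongr a b₀ b)⟩
  rw [← hmp.measure_preimage hE.nullMeasurableSet, ← hmp.measure_preimage hH.nullMeasurableSet]
  have hpre : e.symm ⁻¹' H = H' ×ˢ Set.univ := by
    ext ⟨a, b⟩
    simp [hHH']
  rw [hpre, Measure.prod_prod, measure_univ, mul_one,
    Measure.prod_apply (e.symm.measurable hE), ← lintegral_indicator_const hH']
  refine lintegral_mono fun a => ?_
  by_cases ha : a ∈ H'
  · rw [Set.indicator_of_mem ha]
    have hsec : Prod.mk a ⁻¹' (e.symm ⁻¹' (H ∩ {D | ∀ i ∉ M, D i ∈ G D})) ⊆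
        Set.univ.pi fun _ : {i // i ∉ M} => G (e.symm (a, b₀)) := by
      rintro b ⟨-, hb⟩ ⟨i, hi⟩ -
      have := hb i hi
      rwa [hnotMem a b i hi, hGM _ _ (hcongr a b b₀)] at this
    calc _ ≤ _ := measure_mono hsec
      _ = P (G (e.symm (a, b₀))) ^ (Fintype.card ι - M.card) := by
          rw [Measure.pi_pi, Finset.prod_const, Finset.card_univ, Fintype.card_subtype_compl,
            Fintype.card_coe]
      _ ≤ _ := pow_le_pow_left₀ zero_le (hc _ ha) _
  · have hsec : Prod.mk a ⁻¹' (e.symm ⁻¹' (H ∩ {D | ∀ i ∉ M, D i ∈ G D})) = ∅ :=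
      Set.eq_empty_of_forall_notMem fun b hb => ha ((hHH' a b).1 hb.1)
    rw [hsec, measure_empty]
    exact zero_le

/-! ### Binomial counting and the linear-programming bound -/

section Counting

variable {n : ℕ}

lemma choose_le_card_supersets (C : Finset (Fin n)) {j : ℕ} (hj : C.card ≤ j) :
    (n - C.card).choose (j - C.card) ≤
      {M ∈ Finset.powersetCard j (Finset.univ : Finset (Fin n)) | C ⊆ M}.card := by
  have hcard : (Finset.powersetCard (j - C.card) Cᶜ).card =
      (n - C.card).choose (j - C.card) := by
    rw [Finset.card_powersetCard, Finset.card_compl, Fintype.card_fin]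
  rw [← hcard]
  have hdisj : ∀ S ∈ Finset.powersetCard (j - C.card) Cᶜ, Disjoint C S := fun S hS =>
    Finset.disjoint_left.2 fun i hi hi' =>
      Finset.mem_compl.1 ((Finset.mem_powersetCard.1 hS).1 hi') hi
  refine Finset.card_le_card_of_injOn (C ∪ ·) (fun S hS => ?_) (fun S hS S' hS' h => ?_)
  · have hS2 := (Finset.mem_powersetCard.1 (Finset.mem_coe.1 hS)).2
    simp only [Finset.coe_filter, Finset.mem_powersetCard, Set.mem_ofPred_eq]
    refine ⟨⟨Finset.subset_univ _, ?_⟩, Finset.subset_union_left⟩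
    rw [Finset.card_union_of_disjoint (hdisj S hS), hS2]
    omega
  · rw [← Finset.union_sdiff_cancel_left (hdisj S hS),
      ← Finset.union_sdiff_cancel_left (hdisj S' hS')]
    exact congrArg (· \ C) h

/-- The binomial ratio is the proportion of `j`-sets containing `C`; this makes the weights in
`IsMiscoverage` averages over `M`. -/
lemma choose_div_choose_le (C : Finset (Fin n)) {j : ℕ} (hj : C.card ≤ j) (hjn : j ≤ n) :
    (j.choose C.card : ℝ) / n.choose C.card ≤
      ({M ∈ Finset.powersetCard j (Finset.univ : Finset (Fin n)) | C ⊆ M}.card : ℝ) /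
        n.choose j := by
  have h1 : (0 : ℝ) < n.choose C.card := by exact_mod_cast Nat.choose_pos (hj.trans hjn)
  have h2 : (0 : ℝ) < n.choose j := by exact_mod_cast Nat.choose_pos hjn
  rw [div_le_div_iff₀ h1 h2]
  have h3 := Nat.choose_mul (n := n) hj
  have h4 := Nat.mul_le_mul_left (n.choose C.card) (choose_le_card_supersets C hj)
  rw [← h3] at h4
  rw [mul_comm, mul_comm ((_ : ℕ) : ℝ) ((n.choose C.card : ℕ) : ℝ)]
  exact_mod_cast h4

/-- The linear-programming bound behind the scenario approach: the weights `y M` of the possible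
compressions of each subsample `M` sum up to at most one, and restriction of the full sample to `M`
loses at most a factor `t ^ (n - #M)`. -/
lemma sum_weight_le {x : Finset (Fin n) → ℝ} {y : Finset (Fin n) → Finset (Fin n) → ℝ} {t b : ℝ}
    (ht : 0 < t) (hb : 0 ≤ b) (hx : ∀ C, 0 ≤ x C) (hy : ∀ M C, 0 ≤ y M C)
    (hxy : ∀ M C, C ⊆ M → x C ≤ t ^ (n - M.card) * y M C) (hsum : ∀ M, ∑ C, y M C ≤ 1)
    {K : Finset (Finset (Fin n))}
    (hK : ∀ C ∈ K, 1 ≤ b / n * ∑ j ∈ Finset.Ico C.card n,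
      ((j.choose C.card : ℝ) / n.choose C.card) * (1 / t ^ (n - j))) :
    ∑ C ∈ K, x C ≤ b := by
  have hbn : 0 ≤ b / n := by positivity
  have hterm : ∀ C ∈ K, x C ≤ b / n * ∑ j ∈ Finset.range n, 1 / (n.choose j : ℝ) *
      ∑ M ∈ Finset.powersetCard j Finset.univ, if C ⊆ M then y M C else 0 := fun C hC => by
    have hnn : ∀ j, 0 ≤ 1 / (n.choose j : ℝ) *
        ∑ M ∈ Finset.powersetCard j Finset.univ, if C ⊆ M then y M C else 0 := fun j =>
      mul_nonneg (by positivity) (Finset.sum_nonneg fun M _ => by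
        split_ifs
        · exact hy M C
        · exact le_rfl)
    calc x C ≤ (b / n * ∑ j ∈ Finset.Ico C.card n,
          ((j.choose C.card : ℝ) / n.choose C.card) * (1 / t ^ (n - j))) * x C :=
          le_mul_of_one_le_left (hx C) (hK C hC)
      _ = b / n * ∑ j ∈ Finset.Ico C.card n,
          ((j.choose C.card : ℝ) / n.choose C.card) * (x C / t ^ (n - j)) := by
          rw [mul_assoc, Finset.sum_mul]
          congr 1
          exact Finset.sum_congr rfl fun j _ => by ring
      _ ≤ b / n * ∑ j ∈ Finset.Ico C.card n, 1 / (n.choose j : ℝ) *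
          ∑ M ∈ Finset.powersetCard j Finset.univ, if C ⊆ M then y M C else 0 := by
          refine mul_le_mul_of_nonneg_left (Finset.sum_le_sum fun j hj => ?_) hbn
          obtain ⟨hj1, hj2⟩ := Finset.mem_Ico.1 hj
          refine (mul_le_mul_of_nonneg_right (choose_div_choose_le C hj1 hj2.le)
            (div_nonneg (hx C) (pow_pos ht _).le)).trans ?_
          rw [div_eq_mul_one_div, mul_comm (_ : ℝ) (1 / _), mul_assoc, ← Finset.sum_filter,
            ← nsmul_eq_mul]
          refine mul_le_mul_of_nonneg_left (Finset.card_nsmul_le_sum _ _ _ fun M hM => ?_)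
            (by positivity)
          obtain ⟨hM1, hM2⟩ := Finset.mem_filter.1 hM
          rw [div_le_iff₀ (pow_pos ht _), mul_comm, ← (Finset.mem_powersetCard.1 hM1).2]
          exact hxy M C hM2
      -- Starting the sum at `0` makes its range independent of `C`, so that the sums can be
      -- interchanged.
      _ ≤ _ := by
          refine mul_le_mul_of_nonneg_left
            (Finset.sum_le_sum_of_subset_of_nonneg (fun j hj => ?_) fun j _ _ => hnn j) hbn
          exact Finset.mem_range.2 (Finset.mem_Ico.1 hj).2
  calc ∑ C ∈ K, x C ≤ ∑ C ∈ K, b / n * ∑ j ∈ Finset.range n, 1 / (n.choose j : ℝ) *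
        ∑ M ∈ Finset.powersetCard j Finset.univ, if C ⊆ M then y M C else 0 :=
        Finset.sum_le_sum hterm
    _ = b / n * ∑ j ∈ Finset.range n, 1 / (n.choose j : ℝ) *
        ∑ M ∈ Finset.powersetCard j Finset.univ, ∑ C ∈ K, if C ⊆ M then y M C else 0 := by
        rw [← Finset.mul_sum, Finset.sum_comm]
        congr 1
        refine Finset.sum_congr rfl fun j _ => ?_
        rw [← Finset.mul_sum, Finset.sum_comm]
    _ ≤ b / n * ∑ j ∈ Finset.range n, (1 : ℝ) := by
        refine mul_le_mul_of_nonneg_left (Finset.sum_le_sum fun j hj => ?_) hbn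
        have hpos : (0 : ℝ) < n.choose j := by
          exact_mod_cast Nat.choose_pos (Finset.mem_range.1 hj).le
        rw [one_div, inv_mul_le_iff₀ hpos, mul_one]
        have hle : ∀ M, ∑ C ∈ K, (if C ⊆ M then y M C else 0) ≤ 1 := fun M => by
          refine le_trans (Finset.sum_le_sum fun C _ => ?_)
            ((Finset.sum_le_univ_sum_of_nonneg (hy M)).trans (hsum M))
          split_ifs
          · exact le_rfl
          · exact hy M C
        refine (Finset.sum_le_card_nsmul _ _ 1 fun M _ => hle M).trans ?_
        simp
    _ ≤ b := by
        rw [Finset.sum_const, Finset.card_range, nsmul_eq_mul, mul_one]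
        -- The `n` sizes `j < n` contribute at most `1` each, which cancels the factor `1 / n`.
        rcases eq_or_ne (n : ℝ) 0 with h | h
        · simpa [h] using hb
        · rw [div_mul_cancel₀ _ h]

/-- The left side of the defining equation increases with `e`. This replaces the data-dependent
level by the fixed target `ε`. -/
lemma IsMiscoverage.one_le_of_le {d : ℕ} {b e ε : ℝ} (h : IsMiscoverage n d b e) (hb : 0 ≤ b)
    (heε : e ≤ ε) (hε : ε < 1) :
    1 ≤ b / n * ∑ j ∈ Finset.Ico d n,
      ((j.choose d : ℝ) / n.choose d) * (1 / (1 - ε) ^ (n - j)) := by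
  obtain ⟨-, -, h⟩ := h
  have hpos : 0 < 1 - ε := by linarith
  refine h.ge.trans
    (mul_le_mul_of_nonneg_left (Finset.sum_le_sum fun j _ => ?_) (by positivity))
  gcongr

end Counting

/-! ### The scenario bound for a single rule -/

section Bound

variable {X Y : Type*} [MeasurableSpace X] [MeasurableSpace Y] {nq ns n : ℕ}

/-- The samples on which `C` is the selected compression of the points in `M` and the solution has
coverage below `1 - ε`. -/
def badEvent (P : Measure (X × Y)) (s : X → Y → (Fin nq → ℝ) → (Fin ns → ℝ))
    (A : Multiset (X × Y) → Option (Fin nq → ℝ)) (ε : ℝ) (M C : Finset (Fin n)) :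
    Set (Fin n → X × Y) :=
  {D | Selected s A D M C ∧ coverage P s (solution A C D) < 1 - ε}

variable {P : Measure (X × Y)} [IsProbabilityMeasure P]
  {s : X → Y → (Fin nq → ℝ) → (Fin ns → ℝ)} {A : Multiset (X × Y) → Option (Fin nq → ℝ)} {ε : ℝ}

lemma measurableSet_badEvent
    (hs : Measurable fun p : (X × Y) × (Fin nq → ℝ) => s p.1.1 p.1.2 p.2)
    (hA : MeasurableRule A) (M C : Finset (Fin n)) : MeasurableSet (badEvent P s A ε M C) :=
  (measurableSet_selected hs hA M C).inter (measurableSet_lt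
    ((measurable_coverage P hs).comp (hA.measurable_solution C)) measurable_const)

lemma solution_congr {Z : Type*} {A : Multiset Z → Option (Fin nq → ℝ)} {C : Finset (Fin n)}
    {D D' : Fin n → Z} (h : ∀ i ∈ C, D i = D' i) : solution A C D = solution A C D' := by
  rw [solution, solution, subsample_congr h]

/-- Selection of `C` passes to `M`, and each of the `n - #M` other points must have zero slack at a
solution determined by `M`, which has conditional probability at most `1 - ε`. -/
lemma measureReal_badEvent_le
    (hs : Measurable fun p : (X × Y) × (Fin nq → ℝ) => s p.1.1 p.1.2 p.2)
    (hA : IsStable s A) (hAm : MeasurableRule A) (hε : ε < 1) {M C : Finset (Fin n)}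
    (hCM : C ⊆ M) :
    (Measure.pi fun _ : Fin n => P).real (badEvent P s A ε Finset.univ C) ≤
      (1 - ε) ^ (n - M.card) *
        (Measure.pi fun _ : Fin n => P).real (badEvent P s A ε M C) := by
  have hsub : badEvent P s A ε Finset.univ C ⊆ badEvent P s A ε M C ∩
      {D | ∀ i ∉ M, D i ∈ {z | slack s z (solution A C D) = 0}} := by
    rintro D ⟨hD, hcov⟩
    refine ⟨⟨hD.of_univ hA hCM, hcov⟩, fun i hi => ?_⟩
    obtain ⟨⟨-, q, hq, hz⟩, -⟩ := hD
    have hsol : solution A C D = q := by rw [solution, hq, Option.getD_some]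
    rw [hsol]
    exact hz i (Finset.mem_univ i) fun hiC => hi (hCM hiC)
  have hle := pi_inter_forall_notMem_le P M (measurableSet_badEvent (P := P) (ε := ε) hs hAm M C)
    (G := fun D => {z | slack s z (solution A C D) = 0}) (c := ENNReal.ofReal (1 - ε))
    (fun D D' h hD => ⟨hD.1.congr h, by
      rw [← solution_congr fun i hi => h i (hCM hi)]; exact hD.2⟩)
    (fun i => ((measurable_pi_apply i).prodMk (hAm.measurable_solution C))
      (measurableSet_slack_eq_zero hs))
    (fun D D' h => by simp only [solution_congr fun i hi => h i (hCM hi)])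
    (fun D hD => by
      rw [← ofReal_measureReal]
      refine ENNReal.ofReal_le_ofReal ?_
      rw [← coverage_eq_slack]
      exact hD.2.le)
  have h := ENNReal.toReal_mono (by finiteness) ((measure_mono hsub).trans hle)
  rwa [ENNReal.toReal_mul, ENNReal.toReal_pow, ENNReal.toReal_ofReal (by linarith),
    Fintype.card_fin] at h

/-- Scenario bound for one stable rule: outside an event of probability at most `b`, a valid
solution has the target coverage. -/
lemma exists_measurableSet_forall_isValidSolution
    (hs : Measurable fun p : (X × Y) × (Fin nq → ℝ) => s p.1.1 p.1.2 p.2)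
    (hA : IsStable s A) (hAm : MeasurableRule A) (hε : ε < 1) {b : ℝ} (hb : 0 ≤ b) :
    ∃ B : Set (Fin n → X × Y), MeasurableSet B ∧
      (Measure.pi fun _ : Fin n => P).real B ≤ b ∧
      ∀ D ∉ B, ∀ q, IsValidSolution s A b ε D q → 1 - ε ≤ coverage P s q := by
  classical
  -- Membership depends only on `#C` and holds for the compression behind any valid solution.
  set K : Finset (Finset (Fin n)) := {C | 1 ≤ b / n * ∑ j ∈ Finset.Ico C.card n,
      ((j.choose C.card : ℝ) / n.choose C.card) * (1 / (1 - ε) ^ (n - j))}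
  refine ⟨⋃ C ∈ K, badEvent P s A ε Finset.univ C,
    K.measurableSet_biUnion fun C _ => measurableSet_badEvent hs hAm _ C, ?_, ?_⟩
  · refine (measureReal_biUnion_finset_le K _).trans ?_
    refine sum_weight_le (t := 1 - ε) (by linarith) hb (fun C => measureReal_nonneg)
      (y := fun M C => (Measure.pi fun _ : Fin n => P).real (badEvent P s A ε M C))
      (fun M C => measureReal_nonneg) (fun M C hCM => measureReal_badEvent_le hs hA hAm hε hCM)
      (fun M => ?_) (fun C hC => (Finset.mem_filter.1 hC).2)
    rw [← measureReal_biUnion_finset (fun C _ C' _ hne => Set.disjoint_left.2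
      fun D hD hD' => hne (hD.1.unique hD'.1)) fun C _ => measurableSet_badEvent hs hAm M C]
    exact measureReal_le_one
  · rintro D hD q ⟨hq, e, he, heε⟩
    by_contra! hcov
    obtain ⟨C, hC⟩ := exists_selected (s := s) hq
    obtain ⟨hqC, hcard⟩ := hC.complexity_eq hA hq
    rw [hcard] at he
    refine hD (Set.mem_biUnion (Finset.mem_coe.2 (Finset.mem_filter.2
      ⟨Finset.mem_univ C, he.one_le_of_le hb heε hε⟩)) ⟨hC, ?_⟩)
    rwa [solution, hqC, Option.getD_some]

end Bound

end RelMCP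

/-! ### Union bound over the grid -/

theorem theorem2
    {X Y Ω : Type*} [MeasurableSpace X] [MeasurableSpace Y] [MeasurableSpace Ω]
    {nq ns ncal neval : ℕ}
    -- the unknown data distribution, the score function and the cost function
    (P : Measure (X × Y)) [IsProbabilityMeasure P]
    (s : X → Y → (Fin nq → ℝ) → (Fin ns → ℝ))
    (hs : Measurable fun p : (X × Y) × (Fin nq → ℝ) => s p.1.1 p.1.2 p.2)
    (J : (Fin nq → ℝ) → ℝ)
    -- the predetermined grid of penalty parameters, and how each program is solved
    (φ : Fin neval → ℝ) (hφ : ∀ i, 0 < φ i)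
    (A : Fin neval → Multiset (X × Y) → Option (Fin nq → ℝ))
    (hA : ∀ i, RelMCP.IsSolutionRule s J (φ i) (A i))
    (hAm : ∀ i, RelMCP.MeasurableRule (A i))
    (ε β : ℝ) (hε0 : 0 < ε) (hε1 : ε < 1) (hβ0 : 0 < β) (hβ1 : β < 1)
    -- the i.i.d. calibration data
    (μ : Measure Ω) [IsProbabilityMeasure μ]
    (D : Fin ncal → Ω → X × Y) (hDm : ∀ m, Measurable (D m))
    (hDind : iIndepFun D μ) (hDlaw : ∀ m, μ.map (D m) = P) :
    -- all valid grid solutions simultaneously have the target coverage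
    1 - β ≤ μ.real {ω | ∀ i q,
      RelMCP.IsValidSolution s (A i) (β / neval) ε (fun m => D m ω) q →
        1 - ε ≤ RelMCP.coverage P s q} ∧
    -- hence so has a valid solution that is selected from the grid in any way
    ∀ qstar : Ω → (Fin nq → ℝ),
      (∀ᵐ ω ∂μ, ∃ i,
        RelMCP.IsValidSolution s (A i) (β / neval) ε (fun m => D m ω) (qstar ω)) →
      1 - β ≤ μ.real {ω | 1 - ε ≤ RelMCP.coverage P s (qstar ω)} := by
  set ν := Measure.pi fun _ : Fin ncal => P
  have hDm' : Measurable fun ω m => D m ω := measurable_pi_lambda _ hDm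
  have hlaw : μ.map (fun ω m => D m ω) = ν := by
    rw [(iIndepFun_iff_map_fun_eq_pi_map fun m => (hDm m).aemeasurable).1 hDind]
    simp only [hDlaw, ν]
  have hβn : 0 ≤ β / neval := by positivity
  choose B hBm hBle hB using fun i => RelMCP.exists_measurableSet_forall_isValidSolution
    (n := ncal) (P := P) hs ((hA i).isStable (hφ i)) (hAm i) hε1 hβn
  have hgrid : 1 - β ≤ μ.real {ω | ∀ i q,
      RelMCP.IsValidSolution s (A i) (β / neval) ε (fun m => D m ω) q →
        1 - ε ≤ RelMCP.coverage P s q} := by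
    have hle : ν.real (⋃ i, B i) ≤ β := by
      refine (measureReal_iUnion_fintype_le B).trans
        ((Finset.sum_le_sum fun i _ => hBle i).trans ?_)
      rw [Finset.sum_const, Finset.card_univ, Fintype.card_fin, nsmul_eq_mul]
      rcases eq_or_ne (neval : ℝ) 0 with h | h
      · simpa [h] using hβ0.le
      · rw [mul_div_cancel₀ _ h]
    have hUm : MeasurableSet (⋃ i, B i) := .iUnion hBm
    calc 1 - β ≤ 1 - ν.real (⋃ i, B i) := by linarith
      _ = ν.real (⋃ i, B i)ᶜ := (probReal_compl_eq_one_sub hUm).symm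
      _ = μ.real ((fun ω m => D m ω) ⁻¹' (⋃ i, B i)ᶜ) := by
          rw [← hlaw, map_measureReal_apply hDm' hUm.compl]
      _ ≤ _ := measureReal_mono fun ω hω i q hq =>
          hB i _ (fun hmem => hω (Set.mem_iUnion.2 ⟨i, hmem⟩)) q hq
  refine ⟨hgrid, fun qstar hq => hgrid.trans ?_⟩
  -- Monotonicity of the outer measure suffices, so the selection `qstar` need not be measurable.
  refine ENNReal.toReal_mono (measure_ne_top _ _) (measure_mono_ae ?_)
  filter_upwards [hq] with ω ⟨i, hi⟩ hω using hω i _ hi
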